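/- All graphs are finite, simple and undirected. For a graph $G$ with adjacency matrix $A_G$ over $\mathbb F_2$ and $X\subseteq V(G)$, let $\mathrm{cutrk}_G(X)$ be the rank over $\mathbb F_2$ of the submatrix $A_G[X,V(G)\setminus X]$ (which is $0$ if $X=\emptyset$ or $X=V(G)$). A rank-decomposition of $G$ is a pair $(T,L)$, where $T$ is a tree with at least two nodes in which every node has degree $1$ or $3$, and $L$ is a bijection from $V(G)$ to the set of leaves of $T$. Its width is the maximum of $\mathrm{cutrk}_G(A^e)$ over the edges $e$ of $T$, where $A^e$ is the set of vertices mapped by $L$ into one of the two components of $T-e$. The rank-width of $G$ is the minimum width of a rank-decomposition of $G$, and it is $0$ if $|V(G)|\le 1$. Functions $N,R\colon\mathbb N\to\mathbb N$ are said to witness that a class $\mathcal C$ of graphs admits low rank-width colorings if for every $p\in\mathbb N$, every $G\in\mathcal C$ has a (not necessarily proper) vertex coloring with at most $N(p)$ colors such that the union of any $i\le p$ color classes induces a subgraph of rank-width at most $R(i)$; $\mathcal C$ admits low rank-width colorings if such $N,R$ exist. A function $f\colon\mathbb N\to\mathbb N$ is a $\chi$-bounding function for $\mathcal C$ if $\chi(H)\le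 f(\omega(H))$ for every induced subgraph $H$ of every $G\in\mathcal C$, where $\chi$ is the chromatic number and $\omega$ is the size of a maximum clique; $\mathcal C$ is $\chi$-bounded if it has a $\chi$-bounding function. Proposition. Every class $\mathcal C$ of graphs that admits low rank-width colorings is $\chi$-bounded. More precisely, if $N,R$ witness that $\mathcal C$ admits low rank-width colorings, then the class of all graphs of rank-width at most $R(1)$ has a nondecreasing $\chi$-bounding function, and for every nondecreasing $\chi$-bounding function $f_{R(1)}$ of that class, $q\mapsto N(1)\cdot f_{R(1)}(q)$ is a $\chi$-bounding function for $\mathcal C$. -/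

import Mathlib

universe u

namespace LowRankWidth

/-- A class of finite simple graphs (on vertex types in a universe `u`). -/
abbrev GraphClass : Type (u + 1) := ∀ (V : Type u) [Finite V], SimpleGraph V → Prop

noncomputable section

open Classical in
/-- The cut-rank of `X`: the rank over the binary field of the submatrix of the adjacency matrix
with rows `X` and columns `V ∖ X`. -/
def cutRank {V : Type u} [Finite V] (G : SimpleGraph V) (X : Set V) : ℕ :=
  letI : Fintype ↥(Xᶜ) := Fintype.ofFinite _
  ((G.adjMatrix (ZMod 2)).submatrix (fun x : ↥X => (x : V)) (fun y : ↥(Xᶜ) => (y : V))).rank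

/-- A rank-decomposition of a graph with vertex set `V`: a finite tree with at least two nodes, all
of whose nodes have degree `1` or `3`, and a bijection from `V` to the set of its leaves. -/
structure RankDecomposition (V : Type u) where
  /-- the nodes of the tree -/
  Node : Type
  finite_node : Finite Node
  /-- the tree -/
  tree : SimpleGraph Node
  isTree : tree.IsTree
  two_le_card : 2 ≤ Nat.card Node
  subcubic : ∀ t : Node, (tree.neighborSet t).ncard = 1 ∨ (tree.neighborSet t).ncard = 3
  /-- the bijection from the vertices to the leaves -/
  leaf : V ≃ {t : Node // (tree.neighborSet t).ncard = 1}

/-- For adjacent nodes `a`, `b` of the tree, the vertices mapped to leaves in the component of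
`T - ab` that contains `a`. -/
def RankDecomposition.side {V : Type u} (D : RankDecomposition V) (a b : D.Node) : Set V :=
  {v | (D.tree.deleteEdges {s(a, b)}).Reachable a (D.leaf v : D.Node)}

/-- The width of a rank-decomposition of `G`: the maximum over all tree edges `ab` of the cut-rank
of the bipartition of `V` induced by `ab`. (Each edge is visited in both orientations, that is, with
either side of the bipartition; a set and its complement have the same cut-rank.) -/
def RankDecomposition.width {V : Type u} [Finite V] (D : RankDecomposition V)
    (G : SimpleGraph V) : ℕ∞ :=
  ⨆ (a : D.Node) (b : D.Node) (_ : D.tree.Adj a b), (cutRank G (D.side a b) : ℕ∞)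

/-- The rank-width of a finite graph: the minimum width of a rank-decomposition, and `0` if there is
at most one vertex. -/
def rankWidth {V : Type u} [Finite V] (G : SimpleGraph V) : ℕ∞ :=
  if Nat.card V ≤ 1 then 0 else ⨅ D : RankDecomposition V, D.width G

end

/-- `N` and `Q` witness that `C` admits low rank-width colorings: for all `p`, every graph of `C`
has a (not necessarily proper) vertex coloring with at most `N p` colors such that the union of any
`i ≤ p` color classes induces a subgraph of rank-width at most `Q i`. -/
def IsLowRankWidthColoringBound (C : GraphClass.{u}) (N Q : ℕ → ℕ) : Prop :=
  ∀ (p : ℕ) (V : Type u) [Finite V] (G : SimpleGraph V), C V G →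
    ∃ c : V → Fin (N p), ∀ I : Finset (Fin (N p)), I.card ≤ p →
      rankWidth (G.induce {v : V | c v ∈ I}) ≤ (Q I.card : ℕ∞)

/-- The class `C` admits low rank-width colorings. -/
def AdmitsLowRankWidthColorings (C : GraphClass.{u}) : Prop :=
  ∃ N Q : ℕ → ℕ, IsLowRankWidthColoringBound C N Q

/-- `f` is a `χ`-bounding function for `C`: `χ(H) ≤ f(ω(H))` for every induced subgraph `H` of a
graph of `C`. -/
def IsChiBoundingFunction (C : GraphClass.{u}) (f : ℕ → ℕ) : Prop :=
  ∀ (V : Type u) [Finite V] (G : SimpleGraph V), C V G → ∀ S : Set V,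
    (G.induce S).chromaticNumber ≤ (f (G.induce S).cliqueNum : ℕ∞)

/-- The class `C` is `χ`-bounded. -/
def IsChiBounded (C : GraphClass.{u}) : Prop :=
  ∃ f : ℕ → ℕ, IsChiBoundingFunction C f

/-- The class of all finite graphs of rank-width at most `p`. -/
def rankWidthAtMost (p : ℕ) : GraphClass.{u} :=
  fun _ _ G => rankWidth G ≤ (p : ℕ∞)

end LowRankWidth

/-! Each color class of a low rank-width coloring with p = 1 has rank-width at most R(1), so the
heart of the matter is that bounded rank-width implies χ-boundedness. Rooting a rank-decomposition
gives every vertex a binary address, and cut-rank at most p leaves at most 2^p distinct nonempty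
outer neighborhoods below each node (`exists_isAddressing_of_rankWidth_le`).
`IsAddressing.colorableOn` colors by a double induction on the clique bound w and the number m of
outer neighborhoods.

Vertices sharing a nonempty outer neighborhood have a common neighbor, so w drops on them; hence the
live vertices of a node need few colors. The vertices surviving at s span a trunk. The others that
die on this trunk are moved up to it. Each trunk node other than s lies above a surviving vertex
whose outer neighborhood none of the moved vertices has, so m drops (`ncard_outClasses_trunk_le`).
Vertices dying off the trunk are colored recursively. Edges between the levels only join a trunk to
the next one below, so an extra bit, flipped at each level, separates them (`exists_coloring_dead`).
-/

namespace LowRankWidth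

/-! ### Combining proper colorings of vertex subsets -/

section Coloring

variable {V : Type u} {G : SimpleGraph V}

/-- The vertices of `U` can be properly colored with colors below `K`. -/
def ColorableOn (G : SimpleGraph V) (U : Set V) (K : ℕ) : Prop :=
  ∃ c : V → ℕ, (∀ v ∈ U, c v < K) ∧ ∀ u ∈ U, ∀ v ∈ U, G.Adj u v → c u ≠ c v

theorem ColorableOn.mono {U U' : Set V} {K : ℕ} (h : ColorableOn G U K) (hU : U' ⊆ U) :
    ColorableOn G U' K := by
  obtain ⟨c, h1, h2⟩ := h
  exact ⟨c, fun v hv => h1 v (hU hv), fun u hu v hv => h2 u (hU hu) v (hU hv)⟩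

theorem ColorableOn.union {U U' : Set V} {K K' : ℕ} (h : ColorableOn G U K)
    (h' : ColorableOn G U' K') : ColorableOn G (U ∪ U') (K + K') := by
  classical
  obtain ⟨c, h1, h2⟩ := h
  obtain ⟨c', h1', h2'⟩ := h'
  refine ⟨fun v => if v ∈ U then c v else K + c' v, ?_, ?_⟩
  · rintro v hv
    by_cases hvU : v ∈ U
    · have := h1 v hvU
      simp only [hvU, if_true]
      omega
    · have := h1' v (hv.resolve_left hvU)
      simp only [hvU, if_false]
      omega
  · intro u hu v hv huv
    by_cases huU : u ∈ U <;> by_cases hvU : v ∈ U <;> simp only [huU, hvU, if_true, if_false]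
    · exact h2 u huU v hvU huv
    · have := h1 u huU
      omega
    · have := h1 v hvU
      omega
    · have := h2' u (hu.resolve_left huU) v (hv.resolve_left hvU) huv
      omega

theorem colorableOn_of_forall_not_adj {U : Set V} (h : ∀ u ∈ U, ∀ v ∈ U, ¬ G.Adj u v) :
    ColorableOn G U 1 :=
  ⟨fun _ => 0, fun _ _ => Nat.one_pos, fun u hu v hv huv => absurd huv (h u hu v hv)⟩

theorem colorableOn_of_fibers {U : Set V} {M K : ℕ} (h : V → ℕ) (hM : ∀ v ∈ U, h v < M)
    (hK : ∀ j < M, ColorableOn G {v | v ∈ U ∧ h v = j} K) : ColorableOn G U (M * K) := by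
  choose! c hc1 hc2 using hK
  have hlt : ∀ v ∈ U, c (h v) v < K := fun v hv => hc1 _ (hM v hv) v ⟨hv, rfl⟩
  -- Base-K encoding of the pair (fiber, color in the fiber); division by K recovers the fiber.
  refine ⟨fun v => K * h v + c (h v) v, ?_, ?_⟩
  · intro v hv
    have h1 := hlt v hv
    have h2 : K * (h v + 1) ≤ K * M := Nat.mul_le_mul_left K (hM v hv)
    rw [mul_comm M K]
    show K * h v + c (h v) v < K * M
    rw [mul_add, mul_one] at h2
    omega
  · intro u hu v hv huv heq
    have hu1 := hlt u hu
    have hv1 := hlt v hv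
    have hKpos : 0 < K := by omega
    have hdiv := congrArg (· / K) heq
    simp only [Nat.mul_add_div hKpos, Nat.div_eq_of_lt hu1, Nat.div_eq_of_lt hv1,
      add_zero] at hdiv
    have heq' : K * h u + c (h u) u = K * h v + c (h v) v := heq
    rw [hdiv] at heq'
    exact hc2 (h v) (hM v hv) u ⟨hu, hdiv⟩ v ⟨hv, rfl⟩ huv (Nat.add_left_cancel heq')

theorem colorableOn_of_fibers_of_ncard_le {ι : Type*} {U : Set V} {M K : ℕ} (g : V → ι)
    {S : Set ι} (hS : S.Finite) (hM : S.ncard ≤ M) (hgS : ∀ v ∈ U, g v ∈ S)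
    (hK : ∀ N ∈ S, ColorableOn G {v | v ∈ U ∧ g v = N} K) : ColorableOn G U (M * K) := by
  classical
  have := hS.to_subtype
  let e := Finite.equivFin S
  have hcard : Nat.card S ≤ M := hM
  let h : V → ℕ := fun v => if hv : g v ∈ S then (e ⟨g v, hv⟩ : ℕ) else 0
  refine colorableOn_of_fibers h (fun v hv => ?_) (fun j _ => ?_)
  · simp only [h, dif_pos (hgS v hv)]
    exact (e _).2.trans_le hcard
  · by_cases hj : j < Nat.card S
    · refine (hK (e.symm ⟨j, hj⟩ : S).1 (e.symm ⟨j, hj⟩).2).mono ?_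
      rintro v ⟨hv, hvj⟩
      refine ⟨hv, ?_⟩
      simp only [h, dif_pos (hgS v hv)] at hvj
      have : (⟨g v, hgS v hv⟩ : S) = e.symm ⟨j, hj⟩ := by
        rw [Equiv.eq_symm_apply]
        exact Fin.ext hvj
      exact congrArg Subtype.val this
    · refine ⟨fun _ => 0, ?_, ?_⟩ <;>
      · rintro v ⟨hv, hvj⟩
        simp only [h, dif_pos (hgS v hv)] at hvj
        exact absurd (hvj ▸ (e _).2) hj

end Coloring

/-! ### Extremal prefixes of a list -/

section Prefix

variable {α : Type*}

theorem exists_longest_prefix (P : List α → Prop) {l s : List α} (hs : s <+: l) (hP : P s) :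
    ∃ p, p <+: l ∧ P p ∧ ∀ t, t <+: l → P t → t <+: p := by
  induction l using List.reverseRecOn with
  | nil =>
    obtain rfl := List.prefix_nil.1 hs
    exact ⟨[], hs, hP, fun t ht _ => ht⟩
  | append_singleton l a ih =>
    by_cases hl : P (l ++ [a])
    · exact ⟨_, List.prefix_rfl, hl, fun t ht _ => ht⟩
    · have key : ∀ t, t <+: l ++ [a] → P t → t <+: l := fun t ht hPt =>
        (List.prefix_concat_iff.1 ht).resolve_left (fun h => hl (h ▸ hPt))
      obtain ⟨p, h1, h2, h3⟩ := ih (key s hs hP)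
      exact ⟨p, h1.trans (List.prefix_append _ _), h2, fun t ht hPt => h3 t (key t ht hPt) hPt⟩

theorem exists_shortest_prefix (P : List α → Prop) {l s : List α} (hs : s <+: l) (hP : P s) :
    ∃ p, p <+: l ∧ P p ∧ ∀ t, t <+: l → P t → p <+: t := by
  classical
  have hex : ∃ n, ∃ t, t <+: l ∧ P t ∧ t.length = n := ⟨_, s, hs, hP, rfl⟩
  obtain ⟨p, h1, h2, h3⟩ := Nat.find_spec hex
  exact ⟨p, h1, h2, fun t ht hPt => List.prefix_of_prefix_length_le h1 ht
    (h3 ▸ Nat.find_min' hex ⟨t, ht, hPt, rfl⟩)⟩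

theorem exists_concat_prefix {p l : List α} (h : p <+: l) (hne : l ≠ p) :
    ∃ a, p ++ [a] <+: l := by
  obtain ⟨r, rfl⟩ := h
  cases r with
  | nil => simp at hne
  | cons a r => exact ⟨a, r, by simp⟩

end Prefix

/-! ### Coloring vertices placed in a binary tree with few outer neighborhoods -/

section Addresses

variable {V : Type u}

/-- The neighbors of `v` in `U` whose address does not extend `t`. -/
def outNbrs (G : SimpleGraph V) (U : Set V) (L : V → List Bool) (t : List Bool) (v : V) : Set V :=
  {x | x ∈ U ∧ ¬ t <+: L x ∧ G.Adj v x}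

/-- The nonempty neighborhoods outside of the part at `t` of vertices in the part at `t`. -/
def outClasses (G : SimpleGraph V) (U : Set V) (L : V → List Bool) (t : List Bool) :
    Set (Set V) :=
  {N | N.Nonempty ∧ ∃ v ∈ U, t <+: L v ∧ outNbrs G U L t v = N}

/-- The vertices of the part at `t` that have a neighbor outside of it. -/
def live (G : SimpleGraph V) (U : Set V) (L : V → List Bool) (t : List Bool) : Set V :=
  {v | v ∈ U ∧ t <+: L v ∧ (outNbrs G U L t v).Nonempty}

/-- The vertices of the part at `t` that have no neighbor outside of it. -/
def dead (G : SimpleGraph V) (U : Set V) (L : V → List Bool) (t : List Bool) : Set V :=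
  {v | v ∈ U ∧ t <+: L v ∧ ∀ x ∈ U, G.Adj v x → t <+: L x}

/-- The vertices `U`, placed at the nodes `L` of the binary tree, form a graph in which every part
has at most `m` nonempty outer neighborhoods, each node carries an independent set, and all cliques
have at most `w` vertices. -/
structure IsAddressing (G : SimpleGraph V) (U : Set V) (L : V → List Bool) (m w : ℕ) : Prop where
  ncard_le : ∀ t, (outClasses G U L t).ncard ≤ m
  indep : ∀ u ∈ U, ∀ v ∈ U, L u = L v → ¬ G.Adj u v
  clique : ∀ s : Finset V, (s : Set V) ⊆ U → G.IsClique s → s.card ≤ w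

variable {G : SimpleGraph V} {U U' : Set V} {L : V → List Bool} {m w K : ℕ}
  {s t : List Bool}

theorem outNbrs_inter (hU : U' ⊆ U) (v : V) :
    outNbrs G U' L t v = outNbrs G U L t v ∩ U' := by
  ext x
  simp only [outNbrs, Set.mem_ofPred_eq, Set.mem_inter_iff]
  exact ⟨fun h => ⟨⟨hU h.1, h.2⟩, h.1⟩, fun h => ⟨h.2, h.1.2⟩⟩

theorem ncard_outClasses_mono [Finite V] (hU : U' ⊆ U) (t : List Bool) :
    (outClasses G U' L t).ncard ≤ (outClasses G U L t).ncard := by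
  refine le_trans (Set.ncard_le_ncard ?_ (Set.toFinite _)) (Set.ncard_image_le (Set.toFinite _)
    (f := fun N => N ∩ U'))
  rintro N ⟨hN, v, hv, htv, rfl⟩
  rw [outNbrs_inter hU] at hN ⊢
  exact ⟨_, ⟨hN.mono Set.inter_subset_left, v, hU hv, htv, rfl⟩, rfl⟩

theorem IsAddressing.mono [Finite V] (h : IsAddressing G U L m w) (hU : U' ⊆ U) :
    IsAddressing G U' L m w :=
  ⟨fun t => (ncard_outClasses_mono hU t).trans (h.ncard_le t),
    fun u hu v hv => h.indep u (hU hu) v (hU hv), fun s hs => h.clique s (hs.trans hU)⟩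

/-- Live vertices with the same outer neighborhood N are all adjacent to any fixed x in N. Adding x
to a clique among them shows that their cliques have at most w vertices, so K colors suffice for
each of the at most m neighborhoods. -/
theorem IsAddressing.colorableOn_live [Finite V] (h : IsAddressing G U L m (w + 1))
    (ih : ∀ U', IsAddressing G U' L m w → ColorableOn G U' K) (t : List Bool) :
    ColorableOn G (live G U L t) (m * K) := by
  refine colorableOn_of_fibers_of_ncard_le (outNbrs G U L t) (Set.toFinite (outClasses G U L t))
    (h.ncard_le t) (fun v hv => ⟨hv.2.2, v, hv.1, hv.2.1, rfl⟩) ?_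
  rintro N ⟨⟨x, hx⟩, -⟩
  have hsub : {v | v ∈ live G U L t ∧ outNbrs G U L t v = N} ⊆ U := fun v hv => hv.1.1
  have hmono := h.mono hsub
  refine ih _ ⟨hmono.ncard_le, hmono.indep, fun s hs hcl => ?_⟩
  classical
  have hadj : ∀ v ∈ s, G.Adj v x ∧ x ∈ U := fun v hv => by
    have h1 := (hs hv).2
    rw [← h1] at hx
    exact ⟨hx.2.2, hx.1⟩
  have hxs : x ∉ s := fun hxs => G.irrefl (hadj x hxs).1
  rcases s.eq_empty_or_nonempty with rfl | ⟨v, hv⟩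
  · simp
  have := h.clique (insert x s) ?_ ?_
  · rw [Finset.card_insert_of_notMem hxs] at this
    omega
  · rw [Finset.coe_insert]
    exact Set.insert_subset (hadj v hv).2 (hs.trans hsub)
  · rw [Finset.coe_insert]
    exact hcl.insert fun b hb _ => (hadj b hb).1.symm

theorem mem_live_of_notMem_dead {v : V} (hv : v ∈ U) (ht : t <+: L v) (h : v ∉ dead G U L t) :
    v ∈ live G U L t := by
  refine ⟨hv, ht, ?_⟩
  by_contra hne
  refine h ⟨hv, ht, fun x hx hvx => ?_⟩
  by_contra htx
  exact hne ⟨x, hx, htx, hvx⟩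

theorem dead_of_prefix {v : V} (hst : s <+: t) (h : v ∈ dead G U L t) : v ∈ dead G U L s :=
  ⟨h.1, hst.trans h.2.1, fun x hx hvx => hst.trans (h.2.2 x hx hvx)⟩

/-- Such a vertex sits at p itself, which costs one color, or is live at one of the two children,
each costing m * K. -/
theorem IsAddressing.colorableOn_of_notMem_dead [Finite V] (h : IsAddressing G U L m (w + 1))
    (ih : ∀ U', IsAddressing G U' L m w → ColorableOn G U' K) {X : Set V} {p : List Bool}
    (hX : ∀ v ∈ X, v ∈ U ∧ p <+: L v ∧ ∀ b, v ∉ dead G U L (p ++ [b])) :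
    ColorableOn G X (1 + m * K + m * K) := by
  have h0 : ColorableOn G {v | v ∈ U ∧ L v = p} 1 := colorableOn_of_forall_not_adj
    fun u hu v hv => h.indep u hu.1 v hv.1 (hu.2.trans hv.2.symm)
  refine ((h0.union (h.colorableOn_live ih (p ++ [false]))).union
    (h.colorableOn_live ih (p ++ [true]))).mono fun v hv => ?_
  obtain ⟨hvU, hpv, hd⟩ := hX v hv
  by_cases hLv : L v = p
  · exact Or.inl (Or.inl ⟨hvU, hLv⟩)
  · obtain ⟨b, hb⟩ := exists_concat_prefix hpv hLv
    cases b
    · exact Or.inl (Or.inr (mem_live_of_notMem_dead hvU hb (hd _)))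
    · exact Or.inr (mem_live_of_notMem_dead hvU hb (hd _))

/-- The vertices of the part at `s` that are dead at neither child of `s`. -/
def surviving (G : SimpleGraph V) (U : Set V) (L : V → List Bool) (s : List Bool) : Set V :=
  {v | v ∈ U ∧ s <+: L v ∧ ∀ b, v ∉ dead G U L (s ++ [b])}

/-- `t` lies on a path of the tree from `s` to a surviving vertex at `s`. -/
def OnTrunk (G : SimpleGraph V) (U : Set V) (L : V → List Bool) (s t : List Bool) : Prop :=
  s <+: t ∧ (t = s ∨ ∃ v ∈ surviving G U L s, t <+: L v)

/-- The vertices that die at a node of the trunk of `s`. -/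
def trunkDead (G : SimpleGraph V) (U : Set V) (L : V → List Bool) (s : List Bool) : Set V :=
  {v | v ∈ dead G U L s ∧ ∀ t, s <+: t → v ∈ dead G U L t → OnTrunk G U L s t}

theorem OnTrunk.of_prefix {q : List Bool} (ht : OnTrunk G U L s t) (hsq : s <+: q) (hqt : q <+: t) :
    OnTrunk G U L s q := by
  refine ⟨hsq, ?_⟩
  rcases ht.2 with rfl | ⟨v, hv, htv⟩
  · exact Or.inl (hqt.eq_of_length_le hsq.length_le)
  · exact Or.inr ⟨v, hv, hqt.trans htv⟩

/-- Moving the vertices of `W` up to the trunk decreases the number of outer neighborhoods. -/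
theorem ncard_outClasses_trunk_le [Finite V] (h : IsAddressing G U L (m + 1) w) {W : Set V}
    (hW : W ⊆ trunkDead G U L s \ surviving G U L s) {L' : V → List Bool}
    (hL' : ∀ v ∈ W, L' v <+: L v ∧ OnTrunk G U L s (L' v) ∧
      ∀ t, t <+: L v → OnTrunk G U L s t → t <+: L' v) (t : List Bool) :
    (outClasses G W L' t).ncard ≤ m := by
  have hWU : W ⊆ U := fun v hv => (hW hv).1.1.1
  rcases (outClasses G W L' t).eq_empty_or_nonempty with he | ⟨_, hN₀, v₀, hv₀, htv₀, rfl⟩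
  · simp [he]
  obtain ⟨y, hyW, hyt, -⟩ := hN₀
  -- Only trunk nodes strictly below s can have a nonempty outer neighborhood, because all of W now
  -- sits on the trunk.
  have hts : ¬ t <+: s := fun hts => hyt (hts.trans (hL' y hyW).2.1.1)
  have hst : s <+: t := (List.prefix_or_prefix_of_prefix htv₀ (hL' v₀ hv₀).2.1.1).resolve_left hts
  have htT : OnTrunk G U L s t := (hL' v₀ hv₀).2.1.of_prefix hst htv₀
  have hiff : ∀ x ∈ W, (t <+: L' x ↔ t <+: L x) := fun x hx =>
    ⟨fun h => h.trans (hL' x hx).1, fun h => (hL' x hx).2.2 t h htT⟩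
  have hne : t ≠ s := fun h => hts (h ▸ List.prefix_rfl)
  obtain ⟨z, hz, htz⟩ := htT.2.resolve_left hne
  obtain ⟨b, hb⟩ := exists_concat_prefix hst hne
  -- The surviving vertex z below t has a neighbor x outside the whole child part at s ++ [b].
  -- Vertices of W below t are dead at that child, so they miss x and the class of z is lost.
  obtain ⟨-, -, x, hxU, hxb, hzx⟩ := mem_live_of_notMem_dead hz.1 (hb.trans htz) (hz.2.2 b)
  have hxt : ¬ t <+: L x := fun h => hxb (hb.trans h)
  have hxz : x ∈ outNbrs G U L t z := ⟨hxU, hxt, hzx⟩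
  have hdead : ∀ v ∈ W, t <+: L v → ¬ G.Adj v x := by
    intro v hv htv hvx
    have hvs := (hW hv).2
    have : ∃ b', v ∈ dead G U L (s ++ [b']) := by
      by_contra hcon
      push Not at hcon
      exact hvs ⟨hWU hv, hst.trans htv, hcon⟩
    obtain ⟨b', hb'⟩ := this
    have heq : s ++ [b'] = s ++ [b] :=
      (List.prefix_of_prefix_length_le hb'.2.1 (hb.trans htv) (by simp)).eq_of_length (by simp)
    rw [heq] at hb'
    exact hxb (hb'.2.2 x hxU hvx)
  have hzmem : outNbrs G U L t z ∈ outClasses G U L t := ⟨⟨x, hxz⟩, z, hz.1, htz, rfl⟩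
  have hcard : (outClasses G U L t \ {outNbrs G U L t z}).ncard ≤ m := by
    have := h.ncard_le t
    rw [Set.ncard_sdiff_singleton_of_mem hzmem]
    omega
  refine le_trans ?_ hcard
  refine le_trans (Set.ncard_le_ncard ?_ (Set.toFinite _)) (Set.ncard_image_le (Set.toFinite _)
    (f := fun N => N ∩ W))
  rintro N ⟨hN, v, hv, htv, rfl⟩
  have htv' := (hiff v hv).1 htv
  have hout : outNbrs G W L' t v = outNbrs G U L t v ∩ W := by
    rw [← outNbrs_inter hWU]
    ext a
    simp only [outNbrs, Set.mem_ofPred_eq]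
    exact and_congr_right fun ha => by rw [hiff a ha]
  rw [hout] at hN ⊢
  refine ⟨_, ⟨⟨hN.mono Set.inter_subset_left, v, hWU hv, htv', rfl⟩, fun heq => ?_⟩, rfl⟩
  have heq' : outNbrs G U L t v = outNbrs G U L t z := heq
  rw [← heq'] at hxz
  exact hdead v hv htv' hxz.2.2

/-- Surviving vertices take c colors. The rest are moved to their last trunk node, and c colors
again suffice for the vertices gathered at each node. Every such color class is independent at each
node and has only m outer neighborhoods, so it takes K' colors. -/
theorem IsAddressing.colorableOn_trunkDead [Finite V] {K' : ℕ}
    (h : IsAddressing G U L (m + 1) (w + 1))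
    (ihw : ∀ U', IsAddressing G U' L (m + 1) w → ColorableOn G U' K)
    (ihm : ∀ U' L', IsAddressing G U' L' m (w + 1) → ColorableOn G U' K') (s : List Bool) :
    ColorableOn G (trunkDead G U L s)
      ((1 + (m + 1) * K + (m + 1) * K) + (1 + (m + 1) * K + (m + 1) * K) * K') := by
  set c := 1 + (m + 1) * K + (m + 1) * K with hc
  have hA : ColorableOn G (surviving G U L s) c :=
    h.colorableOn_of_notMem_dead ihw (p := s) fun v hv => hv
  set W := trunkDead G U L s \ surviving G U L s with hW
  have hWU : W ⊆ U := fun v hv => hv.1.1.1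
  have hex : ∀ v ∈ W, ∃ p, p <+: L v ∧ OnTrunk G U L s p ∧
      ∀ t, t <+: L v → OnTrunk G U L s t → t <+: p := fun v hv =>
    exists_longest_prefix _ hv.1.1.2.1 ⟨List.prefix_rfl, Or.inl rfl⟩
  choose! L' hL' using hex
  have hblob : ∀ p, ColorableOn G {v | v ∈ W ∧ L' v = p} c := by
    refine fun p => h.colorableOn_of_notMem_dead ihw (p := p) ?_
    rintro v ⟨hv, rfl⟩
    refine ⟨hWU hv, (hL' v hv).1, fun b hd => ?_⟩
    -- Death at a child of the last trunk node would put that child on the trunk as well.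
    have hT := hv.1.2 _ ((hL' v hv).2.1.1.trans (List.prefix_append _ _)) hd
    have := ((hL' v hv).2.2 _ hd.2.1 hT).length_le
    simp at this
  choose bc hbc1 hbc2 using hblob
  have hWcol : ColorableOn G W (c * K') := by
    refine colorableOn_of_fibers (fun v => bc (L' v) v) (fun v hv => hbc1 _ v ⟨hv, rfl⟩)
      fun j _ => ihm _ L' ⟨?_, ?_, ?_⟩
    · exact ncard_outClasses_trunk_le h (s := s) (fun v hv => hv.1) fun v hv => hL' v hv.1
    · rintro u ⟨hu, huj⟩ v ⟨hv, hvj⟩ huv hadj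
      refine hbc2 (L' v) u ⟨hu, huv⟩ v ⟨hv, rfl⟩ hadj ?_
      rw [hvj, ← huv, huj]
    · exact fun q hq => h.clique q fun v hv => hWU (hq hv).1
  refine (hA.union hWcol).mono fun v hv => ?_
  by_cases hvA : v ∈ surviving G U L s
  · exact Or.inl hvA
  · exact Or.inr ⟨hv, hvA⟩

/-- Induction on the height remaining below s. Off-trunk vertices inherit the coloring of the part
at their first off-trunk node, with the bit flipped; the bit `false` on the trunk of s is what the
next level up relies on. -/
theorem exists_coloring_dead (hO : ∀ s, ColorableOn G (trunkDead G U L s) K) {B : ℕ}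
    (hB : ∀ v, (L v).length ≤ B) (n : ℕ) : ∀ s : List Bool, B < s.length + n →
    ∃ c : V → Bool × ℕ, (∀ v ∈ dead G U L s, (c v).2 < K) ∧
      (∀ u ∈ dead G U L s, ∀ v ∈ dead G U L s, G.Adj u v → c u ≠ c v) ∧
      ∀ v ∈ trunkDead G U L s, (c v).1 = false := by
  classical
  induction n with
  | zero =>
    intro s hs
    have he : ∀ v, v ∉ dead G U L s := fun v hv => by
      have := hv.2.1.length_le
      have := hB v
      omega
    exact ⟨fun _ => (false, 0), fun v hv => absurd hv (he v), fun v hv => absurd hv (he v),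
      fun _ _ => rfl⟩
  | succ n ih =>
    intro s hs
    choose! col hcol1 hcol2 hcol3 using ih
    obtain ⟨o, ho1, ho2⟩ := hO s
    have hex : ∀ v, v ∈ dead G U L s → v ∉ trunkDead G U L s → ∃ q, q <+: L v ∧
        (s <+: q ∧ ¬ OnTrunk G U L s q) ∧
        ∀ t, t <+: L v → (s <+: t ∧ ¬ OnTrunk G U L s t) → q <+: t := by
      intro v hv hvO
      have : ∃ t, s <+: t ∧ v ∈ dead G U L t ∧ ¬ OnTrunk G U L s t := by
        by_contra hcon
        push Not at hcon
        exact hvO ⟨hv, hcon⟩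
      obtain ⟨t, hst, hvt, hT⟩ := this
      exact exists_shortest_prefix _ hvt.2.1 ⟨hst, hT⟩
    choose! q hq1 hq2 hq3 using hex
    have hqdead : ∀ v ∈ dead G U L s, v ∉ trunkDead G U L s → v ∈ dead G U L (q v) := by
      intro v hv hvO
      have : ∃ t, s <+: t ∧ v ∈ dead G U L t ∧ ¬ OnTrunk G U L s t := by
        by_contra hcon
        push Not at hcon
        exact hvO ⟨hv, hcon⟩
      obtain ⟨t, hst, hvt, hT⟩ := this
      exact dead_of_prefix (hq3 v hv hvO t hvt.2.1 ⟨hst, hT⟩) hvt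
    have hqlen : ∀ v ∈ dead G U L s, v ∉ trunkDead G U L s → B < (q v).length + n := by
      intro v hv hvO
      have h1 := (hq2 v hv hvO).1
      have h2 : s.length ≠ (q v).length := fun hl =>
        (hq2 v hv hvO).2 ⟨h1, Or.inl (h1.eq_of_length hl).symm⟩
      have := h1.length_le
      omega
    let c : V → Bool × ℕ := fun v =>
      if v ∈ trunkDead G U L s then (false, o v) else (!(col (q v) v).1, (col (q v) v).2)
    have hcO : ∀ v, v ∈ trunkDead G U L s → c v = (false, o v) := fun v hv => if_pos hv
    have hcN : ∀ v, v ∉ trunkDead G U L s → c v = (!(col (q v) v).1, (col (q v) v).2) :=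
      fun v hv => if_neg hv
    have mixed : ∀ u ∈ dead G U L s, ∀ v ∈ dead G U L s, G.Adj u v → u ∉ trunkDead G U L s →
        v ∈ trunkDead G U L s → c u ≠ c v := by
      intro u hu v hv huv huO hvO heq
      have hud := hqdead u hu huO
      have hqv : q u <+: L v := hud.2.2 v hv.1 huv
      have hvd : v ∉ dead G U L (q u) := fun hd =>
        (hq2 u hu huO).2 (hvO.2 _ (hq2 u hu huO).1 hd)
      -- The neighbor v survives at q u and lies below every node where u is dead, so all those
      -- nodes are on the trunk of q u. Thus u has bit `false` there, flipped to `true` here, while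
      -- v has `false`.
      have huO' : u ∈ trunkDead G U L (q u) := by
        refine ⟨hud, fun t hqt hut => ⟨hqt, Or.inr ⟨v, ⟨hv.1, hqv, fun b hb => ?_⟩,
          hut.2.2 v hv.1 huv⟩⟩⟩
        exact hvd (dead_of_prefix (List.prefix_append _ _) hb)
      have h3 := hcol3 (q u) (hqlen u hu huO) u huO'
      rw [hcO v hvO, hcN u huO, h3] at heq
      simp at heq
    refine ⟨c, fun v hv => ?_, fun u hu v hv huv => ?_, fun v hv => by rw [hcO v hv]⟩
    · by_cases hvO : v ∈ trunkDead G U L s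
      · rw [hcO v hvO]
        exact ho1 v hvO
      · rw [hcN v hvO]
        exact hcol1 _ (hqlen v hv hvO) v (hqdead v hv hvO)
    · by_cases huO : u ∈ trunkDead G U L s <;> by_cases hvO : v ∈ trunkDead G U L s
      · rw [hcO u huO, hcO v hvO]
        exact fun heq => ho2 u huO v hvO huv (congrArg Prod.snd heq)
      · exact (mixed v hv u hu huv.symm hvO huO).symm
      · exact mixed u hu v hv huv huO hvO
      · have hud := hqdead u hu huO
        have hvd := hqdead v hv hvO
        -- A dead vertex has its neighbors in the same part, so adjacent off-trunk vertices leave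
        -- the trunk at the same node.
        have h1 : q v <+: q u := hq3 v hv hvO _ (hud.2.2 v hv.1 huv) (hq2 u hu huO)
        have h2 : q u <+: q v := hq3 u hu huO _ (hvd.2.2 u hu.1 huv.symm) (hq2 v hv hvO)
        have hq : q u = q v := h2.eq_of_length_le h1.length_le
        rw [hcN u huO, hcN v hvO, hq]
        rw [hq] at hud
        intro heq
        refine hcol2 (q v) (hqlen v hv hvO) u hud v hvd huv ?_
        simp only [Prod.mk.injEq, Bool.not_inj_iff] at heq
        exact Prod.ext heq.1 heq.2

theorem colorableOn_two_mul [Finite V] (hO : ∀ s, ColorableOn G (trunkDead G U L s) K) :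
    ColorableOn G U (2 * K) := by
  obtain ⟨B, hB⟩ : ∃ B, ∀ v, (L v).length ≤ B := by
    obtain ⟨B, hB⟩ := (Set.finite_range fun v => (L v).length).bddAbove
    exact ⟨B, fun v => hB ⟨v, rfl⟩⟩
  obtain ⟨c, hc1, hc2, -⟩ := exists_coloring_dead hO hB (B + 1) [] (by simp)
  have hd : ∀ v ∈ U, v ∈ dead G U L [] := fun v hv =>
    ⟨hv, List.nil_prefix, fun _ _ _ => List.nil_prefix⟩
  refine colorableOn_of_fibers (fun v => (c v).1.toNat) (fun v _ => Bool.toNat_lt _)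
    fun j _ => ⟨fun v => (c v).2, fun v hv => hc1 v (hd v hv.1), ?_⟩
  rintro u ⟨hu, huj⟩ v ⟨hv, hvj⟩ huv heq
  have hb : (c u).1.toNat = (c v).1.toNat := huj.trans hvj.symm
  refine hc2 u (hd u hu) v (hd v hv) huv (Prod.ext ?_ heq)
  cases hcu : (c u).1 <;> cases hcv : (c v).1 <;> simp [hcu, hcv] at hb ⊢

/-- The number of colors used for `m` outer neighborhoods and clique number `w`. -/
def colorBound : ℕ → ℕ → ℕ
  | 0, _ => 1
  | _ + 1, 0 => 1
  | w + 1, m + 1 =>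
    2 * ((1 + (m + 1) * colorBound w (m + 1) + (m + 1) * colorBound w (m + 1)) +
      (1 + (m + 1) * colorBound w (m + 1) + (m + 1) * colorBound w (m + 1)) *
        colorBound (w + 1) m)

/-- For w = 0 the set is empty. For m = 0 adjacent vertices have addresses that are prefixes of each
other, contradicting independence at a node. -/
theorem IsAddressing.colorableOn [Finite V] (h : IsAddressing G U L m w) :
    ColorableOn G U (colorBound w m) := by
  induction w generalizing m U L with
  | zero =>
    rw [colorBound]
    refine colorableOn_of_forall_not_adj fun u hu _ _ _ => ?_
    have := h.clique {u} (by simpa using hu) (by simp)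
    simp at this
  | succ w ihw =>
    induction m generalizing U L with
    | zero =>
      rw [colorBound]
      refine colorableOn_of_forall_not_adj fun u hu v hv huv => ?_
      have hemp : ∀ t, outClasses G U L t = ∅ := fun t =>
        (Set.ncard_eq_zero (Set.toFinite _)).1 (Nat.le_zero.1 (h.ncard_le t))
      have key : ∀ u ∈ U, ∀ v ∈ U, G.Adj u v → L u <+: L v := by
        intro u hu v hv huv
        by_contra hn
        have hmem : outNbrs G U L (L u) u ∈ outClasses G U L (L u) :=
          ⟨⟨v, hv, hn, huv⟩, u, hu, List.prefix_rfl, rfl⟩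
        simp [hemp] at hmem
      exact h.indep u hu v hv ((key u hu v hv huv).eq_of_length_le
        (key v hv u hu huv.symm).length_le) huv
    | succ m ihm =>
      rw [colorBound]
      exact colorableOn_two_mul fun s =>
        h.colorableOn_trunkDead (fun U' h' => ihw h') (fun U' L' h' => ihm h') s

end Addresses

/-! ### Sides of an edge in a tree -/

section Tree

variable {W : Type*} {T : SimpleGraph W} {a b c c' x : W}

theorem reachable_deleteEdges_or (hT : T.Connected) (a b x : W) :
    (T.deleteEdges {s(a, b)}).Reachable a x ∨ (T.deleteEdges {s(b, a)}).Reachable b x := by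
  obtain ⟨p⟩ := hT.preconnected a x
  rw [Sym2.eq_swap (a := b)]
  suffices ∀ y, T.Walk y x → (T.deleteEdges {s(a, b)}).Reachable y x ∨
      (T.deleteEdges {s(a, b)}).Reachable a x ∨ (T.deleteEdges {s(a, b)}).Reachable b x by
    rcases this a p with h | h
    · exact Or.inl h
    · exact h
  clear p
  intro y p
  induction p with
  | nil => exact Or.inl (SimpleGraph.Reachable.refl _)
  | @cons y z x h p ih =>
    rcases ih with ih | ih
    · by_cases he : s(y, z) = s(a, b)
      · rcases Sym2.eq_iff.1 he with ⟨rfl, rfl⟩ | ⟨rfl, rfl⟩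
        · exact Or.inr (Or.inr ih)
        · exact Or.inr (Or.inl ih)
      · refine Or.inl (SimpleGraph.Reachable.trans (SimpleGraph.Adj.reachable ?_) ih)
        rw [SimpleGraph.deleteEdges_adj]
        exact ⟨h, he⟩
    · exact Or.inr ih

theorem not_reachable_deleteEdges (hT : T.IsAcyclic) (hab : T.Adj a b) :
    ¬ (T.deleteEdges {s(a, b)}).Reachable a b :=
  SimpleGraph.isBridge_iff.1 (SimpleGraph.isAcyclic_iff_forall_adj_isBridge.1 hT hab)

theorem not_reachable_deleteEdges_and (hT : T.IsAcyclic) (hab : T.Adj a b) :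
    ¬ ((T.deleteEdges {s(a, b)}).Reachable a x ∧ (T.deleteEdges {s(b, a)}).Reachable b x) := by
  rintro ⟨h1, h2⟩
  rw [Sym2.eq_swap] at h2
  exact not_reachable_deleteEdges hT hab (h1.trans h2.symm)

/-- After its first edge ac, a path from a never returns to a, so it avoids the edge ca. -/
theorem eq_or_exists_of_reachable_deleteEdges (h : (T.deleteEdges {s(a, b)}).Reachable a x) :
    x = a ∨ ∃ c, T.Adj a c ∧ c ≠ b ∧ (T.deleteEdges {s(c, a)}).Reachable c x := by
  classical
  obtain ⟨p, hp⟩ := h.exists_isPath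
  cases p with
  | nil => exact Or.inl rfl
  | @cons _ c _ hac p =>
    rw [SimpleGraph.deleteEdges_adj] at hac
    rw [SimpleGraph.Walk.cons_isPath_iff] at hp
    refine Or.inr ⟨c, hac.1, fun hcb => hac.2 (by simp [hcb]), ?_⟩
    refine (SimpleGraph.reachable_deleteEdges_iff_exists_walk).2
      ⟨p.mapLe (SimpleGraph.deleteEdges_le _), fun hmem => hp.2 ?_⟩
    simp only [SimpleGraph.Walk.edges_mapLe_eq_edges] at hmem
    exact p.snd_mem_support_of_mem_edges hmem

/-- Since ca is a bridge, a walk from c that avoids it never meets a, and so does not use ab either.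
-/
theorem reachable_deleteEdges_of_child (hT : T.IsAcyclic) (hac : T.Adj a c) (hcb : c ≠ b)
    (h : (T.deleteEdges {s(c, a)}).Reachable c x) :
    (T.deleteEdges {s(a, b)}).Reachable a x := by
  classical
  obtain ⟨p⟩ := h
  have hap : a ∉ p.support := fun hmem =>
    not_reachable_deleteEdges hT hac.symm ⟨p.takeUntil a hmem⟩
  have hcx : (T.deleteEdges {s(a, b)}).Reachable c x := by
    refine (SimpleGraph.reachable_deleteEdges_iff_exists_walk).2
      ⟨p.mapLe (SimpleGraph.deleteEdges_le _), fun hmem => hap ?_⟩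
    simp only [SimpleGraph.Walk.edges_mapLe_eq_edges] at hmem
    exact p.fst_mem_support_of_mem_edges hmem
  refine SimpleGraph.Reachable.trans (SimpleGraph.Adj.reachable ?_) hcx
  rw [SimpleGraph.deleteEdges_adj]
  refine ⟨hac, fun he => ?_⟩
  rcases Sym2.eq_iff.1 he with ⟨-, h⟩ | ⟨-, h⟩
  · exact hcb h
  · exact hac.ne h.symm

theorem not_reachable_deleteEdges_children (hT : T.IsAcyclic) (hac : T.Adj a c)
    (hac' : T.Adj a c') (hne : c ≠ c') : ¬ ((T.deleteEdges {s(c, a)}).Reachable c x ∧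
      (T.deleteEdges {s(c', a)}).Reachable c' x) := fun h =>
  not_reachable_deleteEdges_and hT hac
    ⟨reachable_deleteEdges_of_child hT hac' hne.symm h.2, h.1⟩

end Tree

/-! ### From rank-decompositions to addresses -/

section Decomposition

variable {V : Type u}

/-- Every part of the addressing `L` within `X` is empty or the side of an edge of `D`. -/
def PartsAreSides (D : RankDecomposition V) (X : Set V) (L : V → List Bool) : Prop :=
  Set.InjOn L X ∧ ∀ t, {v | v ∈ X ∧ t <+: L v} = ∅ ∨
    ∃ a b, D.tree.Adj a b ∧ {v | v ∈ X ∧ t <+: L v} = D.side a b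

/-- Two addressings of disjoint sets are combined by a new root with two children. -/
theorem exists_join {X Y : Set V} (hXY : Disjoint X Y) (L M : V → List Bool)
    (hL : Set.InjOn L X) (hM : Set.InjOn M Y) : ∃ N : V → List Bool, Set.InjOn N (X ∪ Y) ∧
      ∀ t, (t = [] ∨ (∃ t', {v | v ∈ X ∪ Y ∧ t <+: N v} = {v | v ∈ X ∧ t' <+: L v}) ∨
        ∃ t', {v | v ∈ X ∪ Y ∧ t <+: N v} = {v | v ∈ Y ∧ t' <+: M v}) := by
  classical
  refine ⟨fun v => if v ∈ X then false :: L v else true :: M v, ?_, fun t => ?_⟩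
  · intro u hu v hv huv
    by_cases huX : u ∈ X <;> by_cases hvX : v ∈ X <;>
      simp only [huX, hvX, if_true, if_false, List.cons.injEq, true_and, Bool.true_eq_false,
        Bool.false_eq_true, false_and] at huv
    · exact hL huX hvX huv
    · exact hM (hu.resolve_left huX) (hv.resolve_left hvX) huv
  · rcases t with _ | ⟨_ | _, t⟩
    · exact Or.inl rfl
    · refine Or.inr (Or.inl ⟨t, ?_⟩)
      ext v
      by_cases hvX : v ∈ X <;> simp [hvX]
    · refine Or.inr (Or.inr ⟨t, ?_⟩)
      ext v
      by_cases hvX : v ∈ X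
      · simp [hvX, Set.disjoint_left.1 hXY hvX]
      · simp [hvX]

/-- Induction on the number of tree nodes on the side of a. A leaf carries at most one vertex, which
gets the empty address; a node of degree 3 joins the addresses of its two neighbors other than b. -/
theorem exists_partsAreSides_side (D : RankDecomposition V) (n : ℕ) : ∀ a b, D.tree.Adj a b →
    {x | (D.tree.deleteEdges {s(a, b)}).Reachable a x}.ncard ≤ n →
    ∃ L, PartsAreSides D (D.side a b) L := by
  have := D.finite_node
  have hac := D.isTree.isAcyclic
  induction n with
  | zero =>
    intro a b _ hn
    have h := (Set.ncard_eq_zero (Set.toFinite _)).1 (Nat.le_zero.1 hn)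
    exact absurd (SimpleGraph.Reachable.refl a) (Set.eq_empty_iff_forall_notMem.1 h a)
  | succ n ih =>
    intro a b hab hn
    rcases D.subcubic a with h1 | h3
    · have hnb : ∀ c, D.tree.Adj a c → c = b := fun c hc => by
        obtain ⟨d, hd⟩ := Set.ncard_eq_one.1 h1
        have hc' : c ∈ D.tree.neighborSet a := hc
        have hb' : b ∈ D.tree.neighborSet a := hab
        rw [hd] at hc' hb'
        exact (Set.mem_singleton_iff.1 hc').trans (Set.mem_singleton_iff.1 hb').symm
      have hside : ∀ v ∈ D.side a b, (D.leaf v : D.Node) = a := fun v hv =>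
        (eq_or_exists_of_reachable_deleteEdges hv).resolve_right
          fun ⟨c, hc, hcb, _⟩ => hcb (hnb c hc)
      refine ⟨fun _ => [], fun u hu v hv _ => D.leaf.injective
        (Subtype.ext ((hside u hu).trans (hside v hv).symm)), fun t => ?_⟩
      by_cases ht : t = []
      · exact Or.inr ⟨a, b, hab, by simp [ht]⟩
      · exact Or.inl (by simp [ht])
    · obtain ⟨c, c', hcc, hacc, hac', hcb, hcb', hall⟩ : ∃ c c', c ≠ c' ∧ D.tree.Adj a c ∧
          D.tree.Adj a c' ∧ c ≠ b ∧ c' ≠ b ∧ ∀ d, D.tree.Adj a d → d ≠ b → d = c ∨ d = c' := by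
        obtain ⟨c, c', hcc, heq⟩ := Set.ncard_eq_two.1
          (show (D.tree.neighborSet a \ {b}).ncard = 2 by
            rw [Set.ncard_sdiff_singleton_of_mem (s := D.tree.neighborSet a) hab, h3])
        have hc : c ∈ D.tree.neighborSet a \ {b} := heq ▸ Set.mem_insert _ _
        have hc' : c' ∈ D.tree.neighborSet a \ {b} :=
          heq ▸ Set.mem_insert_of_mem _ (Set.mem_singleton _)
        refine ⟨c, c', hcc, hc.1, hc'.1, hc.2, hc'.2, fun d hd hdb => ?_⟩
        have hd' : d ∈ D.tree.neighborSet a \ {b} := ⟨hd, hdb⟩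
        rw [heq] at hd'
        simpa using hd'
      have hsmall : ∀ d, D.tree.Adj a d → d ≠ b →
          {x | (D.tree.deleteEdges {s(d, a)}).Reachable d x}.ncard ≤ n := fun d hd hdb => by
        refine Nat.le_of_lt_succ ((Set.ncard_lt_ncard ?_ (Set.toFinite _)).trans_le hn)
        refine ⟨fun x hx => reachable_deleteEdges_of_child hac hd hdb hx, fun hsub => ?_⟩
        exact not_reachable_deleteEdges hac hd.symm (hsub (SimpleGraph.Reachable.refl a))
      obtain ⟨L, hL1, hL2⟩ := ih c a hacc.symm (hsmall c hacc hcb)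
      obtain ⟨M, hM1, hM2⟩ := ih c' a hac'.symm (hsmall c' hac' hcb')
      have hunion : D.side a b = D.side c a ∪ D.side c' a := by
        refine Set.Subset.antisymm (fun v hv => ?_) (Set.union_subset
          (fun v hv => reachable_deleteEdges_of_child hac hacc hcb hv)
          (fun v hv => reachable_deleteEdges_of_child hac hac' hcb' hv))
        rcases eq_or_exists_of_reachable_deleteEdges hv with hva | ⟨d, hd, hdb, hr⟩
        · have := (D.leaf v).2
          rw [hva, h3] at this
          omega
        · rcases hall d hd hdb with rfl | rfl
          · exact Or.inl hr
          · exact Or.inr hr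
      have hdisj : Disjoint (D.side c a) (D.side c' a) := Set.disjoint_left.2 fun v hv hv' =>
        not_reachable_deleteEdges_children hac hacc hac' hcc ⟨hv, hv'⟩
      obtain ⟨N, hN1, hN2⟩ := exists_join hdisj L M hL1 hM1
      rw [← hunion] at hN1 hN2
      refine ⟨N, hN1, fun t => ?_⟩
      rcases hN2 t with rfl | ⟨t', ht'⟩ | ⟨t', ht'⟩
      · exact Or.inr ⟨a, b, hab, by simp⟩
      · rw [ht']
        exact hL2 t'
      · rw [ht']
        exact hM2 t'

/-- The tree is rooted at a new node subdividing an edge ab, here the one at some leaf a. -/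
theorem RankDecomposition.exists_addresses [Nonempty V] (D : RankDecomposition V) :
    ∃ L : V → List Bool, L.Injective ∧ ∀ t, t = [] ∨ {v | t <+: L v} = ∅ ∨
      ∃ a b, D.tree.Adj a b ∧ {v | t <+: L v} = D.side a b := by
  obtain ⟨v⟩ := ‹Nonempty V›
  obtain ⟨b, hb⟩ := Set.ncard_eq_one.1 (D.leaf v).2
  set a : D.Node := (D.leaf v).1
  have hab : D.tree.Adj a b := by
    have : b ∈ D.tree.neighborSet a := hb ▸ Set.mem_singleton b
    exact this
  obtain ⟨L, hL1, hL2⟩ := exists_partsAreSides_side D _ a b hab le_rfl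
  obtain ⟨M, hM1, hM2⟩ := exists_partsAreSides_side D _ b a hab.symm le_rfl
  have hdisj : Disjoint (D.side a b) (D.side b a) := Set.disjoint_left.2 fun v hv hv' =>
    not_reachable_deleteEdges_and D.isTree.isAcyclic hab ⟨hv, hv'⟩
  have hunion : D.side a b ∪ D.side b a = Set.univ := Set.eq_univ_of_forall fun v =>
    reachable_deleteEdges_or D.isTree.connected a b _
  obtain ⟨N, hN1, hN2⟩ := exists_join hdisj L M hL1 hM1
  rw [hunion] at hN1 hN2
  simp only [Set.mem_univ, true_and] at hN2
  refine ⟨N, Set.injOn_univ.1 hN1, fun t => (hN2 t).imp_right ?_⟩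
  rintro (⟨t', ht'⟩ | ⟨t', ht'⟩)
  · rw [ht']
    exact hL2 t'
  · rw [ht']
    exact hM2 t'

/-- The rows lie in the row space, which has 2 ^ rank elements over the binary field. -/
theorem ncard_range_row_le {m n : Type*} [Finite m] [Fintype n]
    (A : Matrix m n (ZMod 2)) : (Set.range A.row).ncard ≤ 2 ^ A.rank := by
  classical
  rw [A.rank_eq_finrank_span_row]
  have : Finite ↥(Submodule.span (ZMod 2) (Set.range A.row)) := inferInstance
  refine le_trans (Set.ncard_le_ncard (t := (Submodule.span (ZMod 2) (Set.range A.row) : Set _))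
    Submodule.subset_span (Set.toFinite _)) (le_of_eq ?_)
  have h := Module.natCard_eq_pow_finrank (K := ZMod 2)
    (V := ↥(Submodule.span (ZMod 2) (Set.range A.row)))
  rw [Nat.card_zmod] at h
  exact h

theorem ncard_outClasses_le_two_pow_cutRank [Finite V] (G : SimpleGraph V) (L : V → List Bool)
    (t : List Bool) :
    (outClasses G Set.univ L t).ncard ≤ 2 ^ cutRank G {v | t <+: L v} := by
  classical
  set X : Set V := {v | t <+: L v} with hX
  let : Fintype ↥(Xᶜ) := Fintype.ofFinite _
  let A := (G.adjMatrix (ZMod 2)).submatrix (fun x : ↥X => (x : V)) (fun y : ↥(Xᶜ) => (y : V))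
  have hA : (Set.range A.row).ncard ≤ 2 ^ cutRank G X := by
    refine (ncard_range_row_le A).trans (le_of_eq ?_)
    rw [cutRank]
  refine le_trans ?_ hA
  -- The outer neighborhood of v is the support of its row in the cut matrix.
  refine le_trans (Set.ncard_le_ncard ?_ (Set.toFinite _)) (Set.ncard_image_le (Set.toFinite _)
    (f := fun r : ↥(Xᶜ) → ZMod 2 => {x : V | ∃ h : x ∈ Xᶜ, r ⟨x, h⟩ = 1}))
  rintro N ⟨-, v, -, hv, rfl⟩
  refine ⟨A.row ⟨v, hv⟩, ⟨_, rfl⟩, ?_⟩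
  ext x
  simp [outNbrs, A, hX, Matrix.row, SimpleGraph.adjMatrix_apply]

theorem exists_isAddressing_of_rankWidth_le [Finite V] (G : SimpleGraph V) {p : ℕ}
    (h : rankWidth G ≤ p) (S : Set V) :
    ∃ L, IsAddressing G S L (2 ^ p) (G.induce S).cliqueNum := by
  obtain ⟨L, hinj, hL⟩ : ∃ L : V → List Bool, L.Injective ∧
      ∀ t, (outClasses G Set.univ L t).ncard ≤ 2 ^ p := by
    have hnil : ∀ (L : V → List Bool) t, (∀ v, t <+: L v) →
        (outClasses G Set.univ L t).ncard ≤ 2 ^ p := fun L t ht => by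
      have : outClasses G Set.univ L t = ∅ := Set.eq_empty_of_forall_notMem <| by
        rintro _ ⟨⟨x, hx⟩, v, -, -, rfl⟩
        exact hx.2.1 (ht x)
      simp [this]
    have hempty : ∀ (L : V → List Bool) t, {v | t <+: L v} = ∅ →
        (outClasses G Set.univ L t).ncard ≤ 2 ^ p := fun L t ht => by
      have : outClasses G Set.univ L t = ∅ := Set.eq_empty_of_forall_notMem <| by
        rintro _ ⟨-, v, -, hv, -⟩
        exact (ht ▸ hv : v ∈ (∅ : Set V))
      simp [this]
    by_cases hV : Nat.card V ≤ 1
    · have := Finite.card_le_one_iff_subsingleton.1 hV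
      refine ⟨fun _ => [], Function.injective_of_subsingleton _, fun t => ?_⟩
      by_cases ht : t = []
      · exact hnil _ _ fun v => ht ▸ List.prefix_rfl
      · exact hempty _ _ (by simp [ht])
    · rw [rankWidth, if_neg hV] at h
      have : Nonempty V := (Nat.card_pos_iff.1 (by omega)).1
      -- The strict bound p + 1 yields a decomposition without attaining the infimum.
      obtain ⟨D, hD⟩ := iInf_lt_iff.1 (h.trans_lt (ENat.natCast_lt_natCast.2 p.lt_succ_self))
      obtain ⟨L, hinj, hL⟩ := D.exists_addresses
      refine ⟨L, hinj, fun t => ?_⟩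
      rcases hL t with rfl | ht | ⟨a, b, hab, ht⟩
      · exact hnil _ _ fun v => List.nil_prefix
      · exact hempty _ _ ht
      · refine (ncard_outClasses_le_two_pow_cutRank G L t).trans
          (Nat.pow_le_pow_right two_pos ?_)
        rw [ht]
        refine Nat.le_of_lt_succ (ENat.natCast_lt_natCast.1 (lt_of_le_of_lt ?_ hD))
        exact le_iSup_of_le a (le_iSup_of_le b (le_iSup_of_le hab le_rfl))
  refine ⟨L, fun t => (ncard_outClasses_mono (Set.subset_univ S) t).trans (hL t),
    fun u _ v _ huv hadj => hadj.ne (hinj huv), fun s hs hcl => ?_⟩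
  classical
  have hcl' : (G.induce S).IsClique (s.subtype (· ∈ S)) := fun x hx y hy hxy =>
    hcl (Finset.mem_subtype.1 hx) (Finset.mem_subtype.1 hy) fun h => hxy (Subtype.ext h)
  have := hcl'.card_le_cliqueNum
  rwa [Finset.card_subtype, Finset.filter_true_of_mem fun x hx => hs hx] at this

end Decomposition

/-! ### The χ-bounding functions -/

section ChiBounding

variable {V : Type u} {G : SimpleGraph V}

theorem ColorableOn.colorable_induce {S : Set V} {K : ℕ} (h : ColorableOn G S K) :
    (G.induce S).Colorable K := by
  obtain ⟨c, h1, h2⟩ := h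
  exact ⟨SimpleGraph.Coloring.mk (fun v => ⟨c v, h1 v v.2⟩) fun {u v} huv heq =>
    h2 u u.2 v v.2 huv (congrArg Fin.val heq)⟩

theorem colorableOn_of_colorable_induce {S : Set V} {K : ℕ} (h : (G.induce S).Colorable K) :
    ColorableOn G S K := by
  classical
  obtain ⟨c⟩ := h
  refine ⟨fun v => if hv : v ∈ S then (c ⟨v, hv⟩ : ℕ) else 0, fun v hv => ?_,
    fun u hu v hv huv => ?_⟩
  · simp [hv]
  · simp only [dif_pos hu, dif_pos hv]
    have huv' : (G.induce S).Adj ⟨u, hu⟩ ⟨v, hv⟩ := huv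
    exact fun heq => c.valid huv' (Fin.ext heq)

theorem exists_monotone_isChiBoundingFunction_rankWidthAtMost (p : ℕ) :
    ∃ f : ℕ → ℕ, Monotone f ∧ IsChiBoundingFunction (rankWidthAtMost.{u} p) f := by
  -- Partial sums are monotone by construction and dominate their last term, the needed number of
  -- colors.
  refine ⟨fun q => ∑ i ∈ Finset.range (q + 1), colorBound i (2 ^ p), fun a b hab =>
    Finset.sum_le_sum_of_subset (Finset.range_mono (Nat.succ_le_succ hab)), ?_⟩
  intro V _ G hG S
  obtain ⟨L, hL⟩ := exists_isAddressing_of_rankWidth_le G hG S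
  refine hL.colorableOn.colorable_induce.chromaticNumber_le.trans (Nat.cast_le.2 ?_)
  exact Finset.single_le_sum (f := fun i => colorBound i (2 ^ p)) (fun _ _ => Nat.zero_le _)
    (Finset.self_mem_range_succ _)

/-- The N(1) classes get disjoint palettes of equal size; monotonicity of f absorbs the possibly
smaller clique number inside a class. -/
theorem IsLowRankWidthColoringBound.isChiBoundingFunction {C : GraphClass.{u}} {N R f : ℕ → ℕ}
    (h : IsLowRankWidthColoringBound C N R) (hf : Monotone f)
    (hfR : IsChiBoundingFunction (rankWidthAtMost.{u} (R 1)) f) :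
    IsChiBoundingFunction C fun q => N 1 * f q := by
  classical
  intro V _ G hG S
  obtain ⟨c, hc⟩ := h 1 V G hG
  refine (ColorableOn.colorable_induce (colorableOn_of_fibers (fun v => (c v : ℕ))
    (fun v _ => (c v).2) fun j hj => ?_)).chromaticNumber_le
  set I : Finset (Fin (N 1)) := {⟨j, hj⟩} with hI
  set X : Set V := {v | c v ∈ I} with hX
  have hcI : I.card = 1 := Finset.card_singleton _
  have hrw := hc I hcI.le
  rw [hcI] at hrw
  set S' : Set X := {x | (x : V) ∈ S} with hS'
  have hchi := hfR X (G.induce X) hrw S'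
  have hclique : ((G.induce X).induce S').cliqueNum ≤ (G.induce S).cliqueNum := by
    obtain ⟨s, hs⟩ := ((G.induce X).induce S').exists_isNClique_cliqueNum
    let e : ↥S' ↪ ↥S := ⟨fun x => ⟨x.1.1, x.2⟩, fun x y hxy =>
      Subtype.ext (Subtype.ext (by simpa using hxy))⟩
    have hcl : (G.induce S).IsClique (s.map e) := by
      rintro _ hx _ hy hxy
      obtain ⟨x, hxs, rfl⟩ := Finset.mem_map.1 hx
      obtain ⟨y, hys, rfl⟩ := Finset.mem_map.1 hy
      exact hs.isClique hxs hys fun h => hxy (h ▸ rfl)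
    rw [← hs.card_eq, ← Finset.card_map e]
    exact hcl.card_le_cliqueNum
  have hcol : ((G.induce X).induce S').Colorable (f (G.induce S).cliqueNum) :=
    SimpleGraph.chromaticNumber_le_iff_colorable.1
      (hchi.trans (Nat.cast_le.2 (hf hclique)))
  obtain ⟨d⟩ := hcol
  refine colorableOn_of_colorable_induce ⟨SimpleGraph.Coloring.mk
    (fun v => d ⟨⟨v.1, by simpa [hX, hI, Fin.ext_iff] using v.2.2⟩, v.2.1⟩) fun {u v} huv => ?_⟩
  exact d.valid huv

end ChiBounding

end LowRankWidth

theorem mainTheorem8 (C : LowRankWidth.GraphClass.{u}) :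
    (LowRankWidth.AdmitsLowRankWidthColorings C → LowRankWidth.IsChiBounded C) ∧
    ∀ N R : ℕ → ℕ, LowRankWidth.IsLowRankWidthColoringBound C N R →
      (∃ f : ℕ → ℕ, Monotone f ∧
        LowRankWidth.IsChiBoundingFunction (LowRankWidth.rankWidthAtMost.{u} (R 1)) f) ∧
      ∀ f : ℕ → ℕ, Monotone f →
        LowRankWidth.IsChiBoundingFunction (LowRankWidth.rankWidthAtMost.{u} (R 1)) f →
        LowRankWidth.IsChiBoundingFunction C (fun q => N 1 * f q) := by
  have key : ∀ N R : ℕ → ℕ, LowRankWidth.IsLowRankWidthColoringBound C N R →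
      (∃ f : ℕ → ℕ, Monotone f ∧
        LowRankWidth.IsChiBoundingFunction (LowRankWidth.rankWidthAtMost.{u} (R 1)) f) ∧
      ∀ f : ℕ → ℕ, Monotone f →
        LowRankWidth.IsChiBoundingFunction (LowRankWidth.rankWidthAtMost.{u} (R 1)) f →
        LowRankWidth.IsChiBoundingFunction C (fun q => N 1 * f q) := fun N R h =>
    ⟨LowRankWidth.exists_monotone_isChiBoundingFunction_rankWidthAtMost (R 1),
      fun f hf hfR => h.isChiBoundingFunction hf hfR⟩
  refine ⟨?_, key⟩
  rintro ⟨N, R, h⟩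
  obtain ⟨⟨f, hf, hfR⟩, h2⟩ := key N R h
  exact ⟨_, h2 f hf hfR⟩
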